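/- \textbf{Proposition (discreteness).} Let $\Delta$ be a (non-empty) right-angled building of type $M=(m_{ij})_{i,j\in I}$ over a finite index set $I$ (so $m_{ij}\in\{2,\infty\}$ for all $i\neq j$), viewed as a chamber system, and assume that $\Delta$ is semiregular with parameters $(q_i)_{i\in I}$, i.e.\ all $i$-panels have the same, possibly infinite, cardinality $q_i\ge 2$. For every $i\in I$ let $X_i$ be a set with $|X_i|=q_i$ and let $F_i\le \operatorname{Sym}(X_i)$ be any permutation group. Let $\lambda=(\lambda_i)_{i\in I}\colon\Delta\to\prod_{i\in I}X_i$ be a legal colouring: for every $i\in I$ and every $i$-panel $\mathcal P$, the restriction $\lambda_i|_{\mathcal P}\colon\mathcal P\to X_i$ is a bijection, and $\lambda_j|_{\mathcal P}$ is constant for every $j\ne i$. For a type-preserving automorphism $g$ of $\Delta$ and an $i$-panel $\mathcal P$ put \[\sigma_\lambda(g,\mathcal P)=\lambda_i|_{g\mathcal P}\circ g|_{\mathcal P}\circ(\lambda_i|_{\mathcal P})^{-1}\in\operatorname{Sym}(X_i),\] and let \[U(\boldsymbol F)=\{g\in\operatorname{Aut}(\Delta)\mid \sigma_\lambda(g,\mathcal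 P)\in F_i\text{ for every } i\in I\text{ and every }i\text{-panel }\mathcal P\}.\] Equip $U(\boldsymbol F)$, a permutation group of the set of chambers of $\Delta$, with the permutation topology, for which the pointwise stabilisers of finite sets of chambers form a neighbourhood basis of the identity. Consider the conditions: \begin{enumerate} \item[(i)] each $F_i$ acts freely on $X_i$; \item[(ii)] $U(\boldsymbol F)$ acts freely on the set of chambers of $\Delta$; \item[(iii)] $U(\boldsymbol F)$ is a discrete topological group. \end{enumerate} Then (i) and (ii) are equivalent, and they imply (iii). If moreover the Coxeter diagram of $\Delta$ has no isolated nodes (i.e.\ for every $i\in I$ there is some $j\in I$ with $m_{ij}=\infty$), then (i), (ii) and (iii) are equivalent. -/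

import Mathlib

universe u v w

/-! ### Permutation topology -/

/-- The pointwise stabilisers of finite subsets of `X`, as a basis of neighbourhoods of the
identity of a permutation group `G ≤ Sym(X)`. -/
@[reducible]
def permutationBasis {X : Type*} (G : Subgroup (Equiv.Perm X)) : GroupFilterBasis G where
  sets := {V | ∃ Φ : Finset X, V = (fixingSubgroup G (Φ : Set X) : Set G)}
  nonempty := ⟨_, ∅, rfl⟩
  inter_sets := by
    classical
    rintro _ _ ⟨Φ, rfl⟩ ⟨Ψ, rfl⟩
    refine ⟨_, ⟨Φ ∪ Ψ, rfl⟩, fun g hg => ?_⟩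
    simp only [SetLike.mem_coe, mem_fixingSubgroup_iff, Set.mem_inter_iff] at hg ⊢
    exact ⟨fun y hy => hg y (by simp_all), fun y hy => hg y (by simp_all)⟩
  one' := by
    rintro _ ⟨Φ, rfl⟩
    exact one_mem _
  mul' := by
    rintro _ ⟨Φ, rfl⟩
    refine ⟨_, ⟨Φ, rfl⟩, ?_⟩
    rintro _ ⟨a, ha, b, hb, rfl⟩
    exact mul_mem ha hb
  inv' := by
    rintro _ ⟨Φ, rfl⟩
    exact ⟨_, ⟨Φ, rfl⟩, fun g hg => inv_mem hg⟩
  conj' := by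
    classical
    rintro g _ ⟨Φ, rfl⟩
    refine ⟨_, ⟨Φ.image (fun x => g⁻¹ • x), rfl⟩, fun h hh => ?_⟩
    simp only [SetLike.mem_coe, mem_fixingSubgroup_iff, Set.mem_preimage] at hh ⊢
    intro y hy
    have := hh (g⁻¹ • y) (Finset.mem_coe.2 (Finset.mem_image_of_mem _ hy))
    rw [mul_smul, mul_smul, this, smul_inv_smul]

/-- The permutation topology on a permutation group `G ≤ Sym(X)`. -/
@[reducible]
def permutationTopology {X : Type*} (G : Subgroup (Equiv.Perm X)) : TopologicalSpace G :=
  (permutationBasis G).topology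

/-! ### Chamber systems and buildings -/

/-- A chamber system over `I` with set of chambers `C`: for each `i : I`, an equivalence
relation on `C`, called `i`-adjacency. -/
structure ChamberSystem (I C : Type*) where
  adj : I → Setoid C

namespace ChamberSystem

variable {I C : Type*} (S : ChamberSystem I C)

/-- `S.HasGallery f x y`: there is a (non-stuttering) gallery of type `f` from `x` to `y`. -/
inductive HasGallery : List I → C → C → Prop
  | nil (x : C) : HasGallery [] x x
  | cons {i : I} {f : List I} {x y z : C} (hxy : S.adj i x y) (hne : x ≠ y)
      (h : HasGallery f y z) : HasGallery (i :: f) x z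

/-- The `i`-panels (residues of type `{i}`) are the equivalence classes of `i`-adjacency. -/
def Panel (i : I) : Type _ := {P : Set C // P ∈ (S.adj i).classes}

/-- The `i`-panel containing the chamber `c`. -/
def panelOf (i : I) (c : C) : S.Panel i := ⟨{d | S.adj i d c}, Setoid.mem_classes _ c⟩

/-- A building of type `M` (an entry `0` of `M` stands for `∞`): a chamber system in which every
panel has at least two chambers, together with a Weyl distance `δ` such that for each reduced
word `f`, `δ x y` is the element represented by `f` if and only if `x` and `y` are joined by a
gallery of type `f`. -/
def IsBuilding (M : CoxeterMatrix I) : Prop :=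
  (∀ i (P : S.Panel i), P.1.Nontrivial) ∧
  ∃ δ : C → C → M.Group, ∀ (x y : C) (f : List I), M.toCoxeterSystem.IsReduced f →
    (δ x y = M.toCoxeterSystem.wordProd f ↔ S.HasGallery f x y)

/-- All `i`-panels have the same cardinality `q i ≥ 2`. -/
def IsSemiregular (q : I → Cardinal) : Prop :=
  ∀ i, 2 ≤ q i ∧ ∀ P : S.Panel i, Cardinal.mk P.1 = q i

/-- The group of type-preserving automorphisms. -/
def autGroup : Subgroup (Equiv.Perm C) where
  carrier := {g | ∀ i c d, S.adj i (g c) (g d) ↔ S.adj i c d}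
  one_mem' := fun _ _ _ => Iff.rfl
  mul_mem' := fun {g h} hg hh i c d => (hg i (h c) (h d)).trans (hh i c d)
  inv_mem' := fun {g} hg i c d => by simpa using (hg i (g⁻¹ c) (g⁻¹ d)).symm

variable {S}

theorem image_mem_classes (g : S.autGroup) (i : I) (P : S.Panel i) :
    (g : Equiv.Perm C) '' P.1 ∈ (S.adj i).classes := by
  obtain ⟨P, hP⟩ := P
  obtain ⟨c, rfl⟩ := hP
  refine ⟨g.1 c, Set.ext fun d => ?_⟩
  constructor
  · rintro ⟨e, he, rfl⟩
    exact (g.2 i e c).2 he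
  · intro hd
    obtain ⟨e, rfl⟩ := g.1.surjective d
    exact ⟨e, (g.2 i e c).1 hd, rfl⟩

/-- The image of a panel under an automorphism. -/
def mapPanel (g : S.autGroup) {i : I} (P : S.Panel i) : S.Panel i :=
  ⟨(g : Equiv.Perm C) '' P.1, image_mem_classes g i P⟩

/-- The restriction `P → gP` of the automorphism `g` to the panel `P`. -/
def restrictPanel (g : S.autGroup) {i : I} (P : S.Panel i) : P.1 ≃ (mapPanel g P).1 :=
  (g : Equiv.Perm C).image P.1

variable (S)

/-- A legal colouring `C → ∏ i, X i`. -/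
structure LegalColouring (X : I → Type*) where
  toFun : C → ∀ i, X i
  bijOn : ∀ i (P : S.Panel i), Set.BijOn (fun c => toFun c i) P.1 Set.univ
  const : ∀ i (P : S.Panel i) j, j ≠ i → ∀ c ∈ P.1, ∀ d ∈ P.1, toFun c j = toFun d j

end ChamberSystem

namespace ChamberSystem.LegalColouring

variable {I C : Type*} {S : ChamberSystem I C} {X : I → Type*} (col : S.LegalColouring X)

/-- The bijection `P → X i` obtained by restricting the `i`-th colour to an `i`-panel `P`. -/
noncomputable def panelEquiv {i : I} (P : S.Panel i) : P.1 ≃ X i :=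
  ((col.bijOn i P).equiv _).trans (Equiv.Set.univ (X i))

/-- The local action of the automorphism `g` at the `i`-panel `P`. -/
noncomputable def localAction (g : S.autGroup) {i : I} (P : S.Panel i) : Equiv.Perm (X i) :=
  ((col.panelEquiv P).symm.trans (restrictPanel g P)).trans (col.panelEquiv (mapPanel g P))

theorem localAction_apply (g : S.autGroup) {i : I} (P : S.Panel i) {c : C} (hc : c ∈ P.1) :
    col.localAction g P (col.toFun c i) = col.toFun (g.1 c) i := by
  have h : (col.panelEquiv P).symm (col.toFun c i) = ⟨c, hc⟩ :=
    (col.panelEquiv P).symm_apply_eq.2 rfl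
  simp only [localAction, Equiv.trans_apply, h]
  rfl

theorem localAction_eq (g : S.autGroup) {i : I} (P : S.Panel i) (f : Equiv.Perm (X i))
    (h : ∀ c ∈ P.1, f (col.toFun c i) = col.toFun (g.1 c) i) : col.localAction g P = f := by
  ext x
  obtain ⟨c, hc, rfl⟩ := (col.bijOn i P).surjOn (Set.mem_univ x)
  exact (col.localAction_apply g P hc).trans (h c hc).symm

theorem localAction_one {i : I} (P : S.Panel i) : col.localAction 1 P = 1 :=
  col.localAction_eq _ _ _ fun _ _ => rfl

theorem localAction_mul (g h : S.autGroup) {i : I} (P : S.Panel i) :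
    col.localAction (g * h) P = col.localAction g (mapPanel h P) * col.localAction h P := by
  refine col.localAction_eq _ _ _ fun c hc => ?_
  rw [Equiv.Perm.mul_apply, col.localAction_apply h P hc]
  exact col.localAction_apply g (mapPanel h P) ⟨c, hc, rfl⟩

theorem localAction_inv (g : S.autGroup) {i : I} (P : S.Panel i) :
    col.localAction g⁻¹ P = (col.localAction g (mapPanel g⁻¹ P))⁻¹ := by
  refine col.localAction_eq _ _ _ fun c hc => ?_
  have h : g⁻¹.1 c ∈ (mapPanel g⁻¹ P).1 := ⟨c, hc, rfl⟩
  have h2 : g.1 (g⁻¹.1 c) = c := by simp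
  rw [Equiv.Perm.inv_eq_iff_eq, col.localAction_apply g _ h, h2]

/-- The universal group `U(F)`, as a permutation group of the set of chambers: the automorphisms
all of whose local actions at `i`-panels lie in `F i`. -/
def universalGroup (F : ∀ i, Subgroup (Equiv.Perm (X i))) : Subgroup (Equiv.Perm C) where
  carrier := {g | ∃ hg : g ∈ S.autGroup, ∀ i (P : S.Panel i), col.localAction ⟨g, hg⟩ P ∈ F i}
  one_mem' := ⟨one_mem _, fun i P => by
    have := col.localAction_one P
    exact this ▸ one_mem (F i)⟩
  mul_mem' := by
    rintro g h ⟨hg, hgF⟩ ⟨hh, hhF⟩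
    refine ⟨mul_mem hg hh, fun i P => ?_⟩
    have := col.localAction_mul ⟨g, hg⟩ ⟨h, hh⟩ P
    exact this ▸ mul_mem (hgF i _) (hhF i P)
  inv_mem' := by
    rintro g ⟨hg, hgF⟩
    refine ⟨inv_mem hg, fun i P => ?_⟩
    have := col.localAction_inv ⟨g, hg⟩ P
    exact this ▸ inv_mem (hgF i _)

end ChamberSystem.LegalColouring

/-! ### Coxeter diagrams -/

namespace CoxeterMatrix

variable {I : Type*} (M : CoxeterMatrix I)

/-- `m i j = 2` or `m i j = ∞` (encoded by `0`) for all distinct `i`, `j`. -/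
def IsRightAngled : Prop := ∀ i j, i ≠ j → M i j = 2 ∨ M i j = 0

/-- The graph underlying the Coxeter diagram: distinct nodes `i`, `j` are joined by an edge if
and only if `m i j ≠ 2`. -/
def diagram : SimpleGraph I where
  Adj i j := i ≠ j ∧ M i j ≠ 2
  symm := ⟨fun i j h => ⟨h.1.symm, by rw [M.symmetric]; exact h.2⟩⟩
  loopless := ⟨fun _ h => h.1 rfl⟩

end CoxeterMatrix

/-! Inside a panel a chamber is determined by its colour. If every `F i` acts freely, an element of
the universal group that fixes a chamber has trivial local action at each panel through it, so it
fixes all adjacent chambers and, by connectedness, every chamber (`isCancelSMul_universalGroup`). A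
free action has a chamber with trivial stabiliser, which gives discreteness.

The other implications need a supply of elements. By `exists_automorphism`, two legal colourings
that agree at a pair of base chambers are related by an automorphism. This is applied to `col` and
to the colouring obtained by letting some `f ∈ F i` act on the `i`-colours outside a set `A`. The
new colouring is legal if only `i`-panels cross the boundary of `A`, at chambers of `A` whose colour
is fixed by `f`; the automorphism then has local actions `1` or `f` only
(`exists_mem_universalGroup`). With `A` empty, freeness of the universal group forces `f = 1` as
soon as `f` fixes a colour. For discreteness, `A` is the `i`-wing of a chamber `c` whose `i`-colour
is fixed by `f`. If `m i j = ∞`, then `c` can be placed so that a given finite set lies deep inside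
the wing (`exists_far_chamber`, `follow_mem_wing`); the automorphism fixes that set, yet acts as `f`
on the panel of `c`.

The combinatorics of galleries rests on the word problem: words without a cancellation up to
commutations are exactly the reduced ones (`isReduced_of_isNormal`). -/

/-! ### Words in right-angled Coxeter groups -/

namespace CoxeterMatrix

variable {I : Type*} (M : CoxeterMatrix I)

/-- The letter `k` occurs in the word, and the first occurrence is preceded only by letters that
commute with `k`. -/
def CanMoveToFront (k : I) : List I → Prop
  | [] => False
  | j :: l => k = j ∨ (M k j = 2 ∧ CanMoveToFront k l)

/-- No letter of the word can be cancelled against a later one after commutations. -/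
def IsNormal : List I → Prop
  | [] => True
  | j :: l => ¬ M.CanMoveToFront j l ∧ IsNormal l

variable {M}

theorem ne_of_apply_eq_two {i j : I} (h : M i j = 2) : i ≠ j := by
  rintro rfl
  simp at h

theorem ne_of_apply_eq_zero {i j : I} (h : M i j = 0) : i ≠ j := by
  rintro rfl
  simp at h

theorem CanMoveToFront.append {k : I} {l : List I} (h : M.CanMoveToFront k l) (t : List I) :
    M.CanMoveToFront k (l ++ t) := by
  induction l with
  | nil => exact h.elim
  | cons a l ih => exact h.imp id fun h => ⟨h.1, ih h.2⟩

theorem CanMoveToFront.of_append_singleton {k a : I} {l : List I}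
    (h : M.CanMoveToFront k (l ++ [a])) (hl : ¬ M.CanMoveToFront k l) :
    k = a ∧ ∀ b ∈ l, M k b = 2 := by
  induction l with
  | nil => exact ⟨h.resolve_right fun h => h.2, by simp⟩
  | cons b l ih =>
    rcases h with h | ⟨h2, h⟩
    · exact (hl (Or.inl h)).elim
    · obtain ⟨h3, h4⟩ := ih h fun h => hl (Or.inr ⟨h2, h⟩)
      exact ⟨h3, by simpa using ⟨h2, h4⟩⟩

theorem IsNormal.of_append {l t : List I} (h : M.IsNormal (l ++ t)) : M.IsNormal l := by
  induction l with
  | nil => trivial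
  | cons a l ih => exact ⟨fun hl => h.1 (hl.append t), ih h.2⟩

local notation "cs" => M.toCoxeterSystem

theorem simple_mul_simple_comm {i j : I} (h : M i j = 2) :
    (cs).simple i * (cs).simple j = (cs).simple j * (cs).simple i := by
  have h1 := (cs).simple_mul_simple_pow i j
  rw [h, pow_two] at h1
  have h2 := eq_inv_of_mul_eq_one_left h1
  rw [mul_inv_rev, (cs).inv_simple, (cs).inv_simple] at h2
  exact h2

theorem wordProd_comm {k : I} {l : List I} (h : ∀ b ∈ l, M k b = 2) :
    (cs).wordProd (k :: l) = (cs).wordProd (l ++ [k]) := by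
  induction l with
  | nil => rfl
  | cons a l ih =>
    rw [List.forall_mem_cons] at h
    rw [List.cons_append, (cs).wordProd_cons a, ← ih h.2]
    simp only [(cs).wordProd_cons]
    rw [← mul_assoc, simple_mul_simple_comm h.1, mul_assoc]

theorem CanMoveToFront.exists_perm {k : I} {l : List I} (h : M.CanMoveToFront k l) :
    ∃ t, l.Perm (k :: t) ∧ (cs).wordProd l = (cs).wordProd (k :: t) := by
  induction l with
  | nil => exact h.elim
  | cons a l ih =>
    rcases h with rfl | ⟨h2, h⟩
    · exact ⟨l, List.Perm.refl _, rfl⟩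
    · obtain ⟨t, ht, hp⟩ := ih h
      refine ⟨a :: t, (ht.cons a).trans (List.Perm.swap _ _ _), ?_⟩
      rw [(cs).wordProd_cons, hp]
      simp only [(cs).wordProd_cons]
      rw [← mul_assoc, ← simple_mul_simple_comm h2, mul_assoc]

/-- This descent description does not mention the word, so being movable to the front will depend
only on the group element. -/
theorem CanMoveToFront.isLeftDescent {k : I} {l : List I} (h : M.CanMoveToFront k l)
    (hl : (cs).IsReduced l) : (cs).IsLeftDescent ((cs).wordProd l) k := by
  obtain ⟨t, ht, hp⟩ := h.exists_perm
  unfold CoxeterSystem.IsLeftDescent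
  rw [hl.eq, hp, (cs).wordProd_cons, (cs).simple_mul_simple_cancel_left, ht.length_eq,
    List.length_cons]
  exact Nat.lt_succ_of_le ((cs).length_wordProd_le t)

theorem isNormal_of_isReduced {l : List I} (h : (cs).IsReduced l) : M.IsNormal l := by
  induction l with
  | nil => trivial
  | cons a l ih =>
    have hl : (cs).IsReduced l := h.drop 1
    refine ⟨fun ha => ?_, ih hl⟩
    have h1 := ha.isLeftDescent hl
    unfold CoxeterSystem.IsLeftDescent at h1
    rw [← (cs).wordProd_cons, h.eq, hl.eq] at h1
    simp at h1

/-! ### The geometric representation and positivity of roots -/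

section Reflection

variable [Fintype I]

/-- The sum of the coordinates at the nodes adjacent to `k`. -/
def neighborSum (M : CoxeterMatrix I) (k : I) (v : I → ℤ) : ℤ :=
  ∑ l, if M k l = 0 then v l else 0

theorem apply_le_neighborSum {k j : I} (h : M k j = 0) {v : I → ℤ} (hv : 0 ≤ v) :
    v j ≤ M.neighborSum k v := by
  have h1 : (if M k j = 0 then v j else 0) ≤ M.neighborSum k v :=
    Finset.single_le_sum (f := fun l => if M k l = 0 then v l else 0)
      (fun l _ => by split_ifs; exacts [hv l, le_rfl]) (Finset.mem_univ j)
  rwa [if_pos h] at h1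

variable [DecidableEq I]

/-- The simple reflection, in root coordinates, of the geometric representation of a right-angled
Coxeter group. -/
def simpleReflection (M : CoxeterMatrix I) (k : I) : Module.End ℤ (I → ℤ) where
  toFun v := Function.update v k (2 * M.neighborSum k v - v k)
  map_add' a b := by
    ext l
    rcases eq_or_ne l k with rfl | h
    · simp only [neighborSum, Function.update_self, Pi.add_apply]
      have : ∀ x, (if M l x = 0 then a x + b x else 0)
          = (if M l x = 0 then a x else 0) + (if M l x = 0 then b x else 0) := by
        intro x; split_ifs <;> simp
      simp only [this, Finset.sum_add_distrib]
      ring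
    · simp [h]
  map_smul' r a := by
    ext l
    rcases eq_or_ne l k with rfl | h
    · simp only [neighborSum, Function.update_self, Pi.smul_apply, smul_eq_mul, RingHom.id_apply]
      have : ∀ x, (if M l x = 0 then r * a x else 0) = r * (if M l x = 0 then a x else 0) := by
        intro x; split_ifs <;> simp
      simp only [this, ← Finset.mul_sum]
      ring
    · simp [h]

theorem simpleReflection_apply (k : I) (v : I → ℤ) :
    M.simpleReflection k v = Function.update v k (2 * M.neighborSum k v - v k) := rfl

theorem neighborSum_update_of_ne {k j : I} (h : M k j ≠ 0) (v : I → ℤ) (x : ℤ) :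
    M.neighborSum k (Function.update v j x) = M.neighborSum k v := by
  refine Finset.sum_congr rfl fun l _ => ?_
  rcases eq_or_ne l j with rfl | hl
  · simp [h]
  · simp [hl]

theorem neighborSum_update {k j : I} (h : M k j = 0) (v : I → ℤ) (x : ℤ) :
    M.neighborSum k (Function.update v j x) = M.neighborSum k v + (x - v j) := by
  rw [← sub_eq_iff_eq_add', neighborSum, neighborSum, ← Finset.sum_sub_distrib,
    Finset.sum_eq_single j]
  · simp [h]
  · intro l _ hl
    simp [hl]
  · simp

theorem simpleReflection_sq (k : I) : M.simpleReflection k * M.simpleReflection k = 1 := by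
  refine LinearMap.ext fun v => ?_
  rw [Module.End.mul_apply, simpleReflection_apply, simpleReflection_apply,
    neighborSum_update_of_ne (by simp)]
  simp

theorem simpleReflection_comm {i j : I} (h : M i j = 2) :
    M.simpleReflection i * M.simpleReflection j = M.simpleReflection j * M.simpleReflection i := by
  have h' : M j i = 2 := by rw [M.symmetric, h]
  have hij := ne_of_apply_eq_two h
  refine LinearMap.ext fun v => ?_
  simp only [Module.End.mul_apply, simpleReflection_apply]
  rw [neighborSum_update_of_ne (by simp [h]), neighborSum_update_of_ne (by simp [h']),
    Function.update_of_ne hij, Function.update_of_ne hij.symm, Function.update_comm hij]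

theorem IsRightAngled.isLiftable (hM : M.IsRightAngled) : M.IsLiftable M.simpleReflection := by
  intro i j
  rcases eq_or_ne i j with rfl | hij
  · simp [simpleReflection_sq]
  · rcases hM i j hij with h | h
    · rw [h, pow_two, mul_assoc, ← mul_assoc (M.simpleReflection j), ← simpleReflection_comm h,
        mul_assoc, simpleReflection_sq, mul_one, simpleReflection_sq]
    · rw [h, pow_zero]

/-- The geometric representation of a right-angled Coxeter group, in root coordinates. -/
def IsRightAngled.rep (hM : M.IsRightAngled) : M.Group →* Module.End ℤ (I → ℤ) :=
  (cs).lift ⟨M.simpleReflection, hM.isLiftable⟩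

theorem IsRightAngled.rep_simple (hM : M.IsRightAngled) (i : I) :
    hM.rep ((cs).simple i) = M.simpleReflection i :=
  (cs).lift_apply_simple hM.isLiftable i

theorem IsRightAngled.rep_cons (hM : M.IsRightAngled) (i : I) (l : List I) (v : I → ℤ) :
    hM.rep ((cs).wordProd (i :: l)) v = M.simpleReflection i (hM.rep ((cs).wordProd l) v) := by
  rw [(cs).wordProd_cons, map_mul, hM.rep_simple, Module.End.mul_apply]

/-- The third clause is the invariant that drives the induction: it says that the reflection in any
letter that may be prepended does not decrease its coordinate. -/
theorem IsRightAngled.rep_single_pos (hM : M.IsRightAngled) {i : I} {l : List I}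
    (h : M.IsNormal (l ++ [i])) :
    0 ≤ hM.rep ((cs).wordProd l) (Pi.single i 1) ∧
    1 ≤ hM.rep ((cs).wordProd l) (Pi.single i 1) i ∧
    ∀ k, ¬ M.CanMoveToFront k (l ++ [i]) →
      hM.rep ((cs).wordProd l) (Pi.single i 1) k ≤
        M.neighborSum k (hM.rep ((cs).wordProd l) (Pi.single i 1)) := by
  induction l with
  | nil =>
    have h0 : (0 : I → ℤ) ≤ Pi.single i 1 := by simp
    rw [(cs).wordProd_nil, map_one, Module.End.one_apply]
    refine ⟨h0, by simp, fun k hk => ?_⟩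
    have hki : k ≠ i := fun h => hk (Or.inl h)
    rw [Pi.single_eq_of_ne hki]
    exact Finset.sum_nonneg fun l _ => by split_ifs; exacts [h0 l, le_rfl]
  | cons j l ih =>
    obtain ⟨hj, hl⟩ := h
    obtain ⟨h0, h1, h2⟩ := ih hl
    rw [hM.rep_cons, simpleReflection_apply]
    set v := hM.rep ((cs).wordProd l) (Pi.single i 1)
    have hjv := h2 j hj
    have hle : v ≤ Function.update v j (2 * M.neighborSum j v - v j) := by
      rw [le_update_iff]
      exact ⟨by linarith, fun _ _ => le_rfl⟩
    refine ⟨h0.trans hle, h1.trans (hle i), fun k hk => ?_⟩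
    have hkj : k ≠ j := fun h => hk (Or.inl h)
    rw [Function.update_of_ne hkj]
    rcases hM k j hkj with hc | hc
    · rw [neighborSum_update_of_ne (by simp [hc])]
      exact h2 k fun h => hk (Or.inr ⟨hc, h⟩)
    -- The neighbour sum at `k` grows by twice the gap at `j`; since `j` and `k` are neighbours,
    -- each coordinate is at most the neighbour sum at the other node.
    · rw [neighborSum_update hc]
      have := apply_le_neighborSum hc h0
      have := apply_le_neighborSum (M := M) (k := j) (j := k) (by rw [M.symmetric, hc]) h0
      linarith

end Reflection

/-- If appending `i` to a reduced word for `w` shortened it, both `w` and `w s_i` would send the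
simple root of `i` to a vector with positive `i`-coordinate, but these two vectors are opposite. -/
theorem IsRightAngled.isReduced_of_isNormal [Finite I] (hM : M.IsRightAngled) {l : List I}
    (h : M.IsNormal l) : (cs).IsReduced l := by
  classical
  cases nonempty_fintype I
  induction l using List.reverseRecOn with
  | nil => simp [CoxeterSystem.IsReduced]
  | append_singleton l i ih =>
    have hl := ih h.of_append
    by_contra hn
    have hlen : (cs).length ((cs).wordProd l * (cs).simple i) + 1 = l.length := by
      rcases (cs).length_mul_simple ((cs).wordProd l) i with h1 | h1
      · refine (hn ?_).elim
        unfold CoxeterSystem.IsReduced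
        rw [(cs).wordProd_append, (cs).wordProd_singleton, h1, hl.eq]
        simp
      · rw [h1, hl.eq]
    obtain ⟨t, ht, htp⟩ := (cs).exists_isReduced ((cs).wordProd l * (cs).simple i)
    have hti : (cs).wordProd (t ++ [i]) = (cs).wordProd l := by
      rw [(cs).wordProd_append, (cs).wordProd_singleton, ← htp,
        (cs).simple_mul_simple_cancel_right]
    have htn : M.IsNormal (t ++ [i]) := by
      refine isNormal_of_isReduced ?_
      unfold CoxeterSystem.IsReduced
      rw [hti, hl.eq, ← hlen, htp, ht.eq]
      simp
    have h1 := (hM.rep_single_pos h).2.1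
    have h2 := (hM.rep_single_pos htn).2.1
    have h3 : M.simpleReflection i (Pi.single i 1) = -Pi.single i 1 := by
      ext k
      rw [simpleReflection_apply]
      rcases eq_or_ne k i with rfl | hk
      · have : M.neighborSum k (Pi.single k 1) = 0 := by
          refine Finset.sum_eq_zero fun l _ => ?_
          split_ifs with hl
          · exact Pi.single_eq_of_ne (ne_of_apply_eq_zero hl).symm _
          · rfl
        simp [this]
      · simp [hk]
    rw [← hti, (cs).wordProd_append, (cs).wordProd_singleton, map_mul, hM.rep_simple,
      Module.End.mul_apply, h3, map_neg, Pi.neg_apply] at h1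
    linarith

theorem IsRightAngled.isLeftDescent_iff [Finite I] (hM : M.IsRightAngled) {l : List I}
    (hl : M.IsNormal l) {k : I} :
    (cs).IsLeftDescent ((cs).wordProd l) k ↔ M.CanMoveToFront k l := by
  refine ⟨fun h => ?_, fun h => h.isLeftDescent (hM.isReduced_of_isNormal hl)⟩
  by_contra hk
  have h1 : (cs).IsReduced (k :: l) := hM.isReduced_of_isNormal ⟨hk, hl⟩
  unfold CoxeterSystem.IsLeftDescent at h
  rw [← (cs).wordProd_cons, h1.eq, (hM.isReduced_of_isNormal hl).eq] at h
  simp at h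

/-- The only possible new cancellation is between the appended `k` and an earlier `k` that commutes
with everything after it; that earlier letter can be moved to the end. -/
theorem IsNormal.exists_append_singleton {l : List I} (hl : M.IsNormal l) {k : I}
    (h : ¬ M.IsNormal (l ++ [k])) :
    ∃ t, l.Perm (t ++ [k]) ∧ (cs).wordProd l = (cs).wordProd (t ++ [k]) := by
  induction l with
  | nil => exact (h ⟨fun h => h, trivial⟩).elim
  | cons a l ih =>
    by_cases h1 : M.IsNormal (l ++ [k])
    · have h2 : M.CanMoveToFront a (l ++ [k]) := by
        by_contra h2
        exact h ⟨h2, h1⟩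
      obtain ⟨rfl, hc⟩ := h2.of_append_singleton hl.1
      exact ⟨l, (List.perm_append_singleton a l).symm, wordProd_comm hc⟩
    · obtain ⟨t, ht, hp⟩ := ih hl.2 h1
      exact ⟨a :: t, ht.cons a, by rw [List.cons_append, (cs).wordProd_cons, hp,
        (cs).wordProd_cons]⟩

end CoxeterMatrix

/-! ### Galleries in right-angled buildings -/

namespace ChamberSystem

variable {I C : Type*} {S : ChamberSystem I C}

theorem hasGallery_append_iff {f g : List I} {x z : C} :
    S.HasGallery (f ++ g) x z ↔ ∃ y, S.HasGallery f x y ∧ S.HasGallery g y z := by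
  induction f generalizing x with
  | nil =>
    refine ⟨fun h => ⟨x, .nil x, h⟩, ?_⟩
    rintro ⟨y, ⟨⟩, h⟩
    exact h
  | cons i f ih =>
    constructor
    · rintro (_ | ⟨hxy, hne, h⟩)
      obtain ⟨a, ha, hz⟩ := ih.1 h
      exact ⟨a, .cons hxy hne ha, hz⟩
    · rintro ⟨a, _ | ⟨hxy, hne, h⟩, hz⟩
      exact .cons hxy hne (ih.2 ⟨a, h, hz⟩)

theorem hasGallery_singleton_iff {i : I} {x y : C} :
    S.HasGallery [i] x y ↔ S.adj i x y ∧ x ≠ y := by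
  constructor
  · rintro (_ | ⟨hxy, hne, ⟨⟩⟩)
    exact ⟨hxy, hne⟩
  · exact fun h => .cons h.1 h.2 (.nil y)

namespace IsBuilding

variable {M : CoxeterMatrix I} (hS : S.IsBuilding M) (hM : M.IsRightAngled)
include hS

theorem exists_hasGallery (x y : C) : ∃ f, M.IsNormal f ∧ S.HasGallery f x y := by
  obtain ⟨δ, hδ⟩ := hS.2
  obtain ⟨f, hf, hfp⟩ := M.toCoxeterSystem.exists_isReduced (δ x y)
  exact ⟨f, CoxeterMatrix.isNormal_of_isReduced hf, (hδ x y f hf).1 hfp⟩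

variable [Finite I]
include hM

theorem wordProd_eq {f g : List I} (hf : M.IsNormal f) (hg : M.IsNormal g) {x y : C}
    (hxy : S.HasGallery f x y) (hxy' : S.HasGallery g x y) :
    M.toCoxeterSystem.wordProd f = M.toCoxeterSystem.wordProd g := by
  obtain ⟨δ, hδ⟩ := hS.2
  rw [← (hδ x y f (hM.isReduced_of_isNormal hf)).2 hxy,
    ← (hδ x y g (hM.isReduced_of_isNormal hg)).2 hxy']

theorem hasGallery_congr {f g : List I} (hf : M.IsNormal f) (hg : M.IsNormal g)
    (hfg : M.toCoxeterSystem.wordProd f = M.toCoxeterSystem.wordProd g) {x y : C}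
    (hxy : S.HasGallery f x y) : S.HasGallery g x y := by
  obtain ⟨δ, hδ⟩ := hS.2
  rw [← hδ x y g (hM.isReduced_of_isNormal hg), ← hfg,
    hδ x y f (hM.isReduced_of_isNormal hf)]
  exact hxy

theorem eq_nil_of_hasGallery_self {f : List I} (hf : M.IsNormal f) {x : C}
    (h : S.HasGallery f x x) : f = [] := by
  have h1 := hS.wordProd_eq hM hf (g := []) trivial h (.nil x)
  have h2 := (hM.isReduced_of_isNormal hf).eq
  rw [h1, M.toCoxeterSystem.wordProd_nil, M.toCoxeterSystem.length_one] at h2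
  exact List.length_eq_zero_iff.1 h2.symm

theorem hasGallery_swap {i j : I} (h : M i j = 2) {x y : C} (hxy : S.HasGallery [i, j] x y) :
    S.HasGallery [j, i] x y := by
  have hij := CoxeterMatrix.ne_of_apply_eq_two h
  refine hS.hasGallery_congr hM (f := [i, j]) ?_ ?_ ?_ hxy
  · simpa [CoxeterMatrix.IsNormal, CoxeterMatrix.CanMoveToFront] using hij
  · simpa [CoxeterMatrix.IsNormal, CoxeterMatrix.CanMoveToFront] using hij.symm
  · simpa [CoxeterSystem.wordProd_cons] using CoxeterMatrix.simple_mul_simple_comm h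

end IsBuilding

/-! ### Coloured walks and automorphisms from colourings -/

namespace LegalColouring

variable {X : I → Type*} (col col' : S.LegalColouring X)

theorem apply_eq_of_adj {i j : I} (hji : j ≠ i) {c d : C} (h : S.adj i c d) :
    col.toFun c j = col.toFun d j :=
  col.const i (S.panelOf i d) j hji c h d ((S.adj i).refl d)

theorem eq_of_adj {i : I} {c d : C} (h : S.adj i c d) (hcd : col.toFun c i = col.toFun d i) :
    c = d :=
  (col.bijOn i (S.panelOf i d)).injOn h ((S.adj i).refl d) hcd

/-- The chamber with `i`-colour `x` in the `i`-panel of `c`. -/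
noncomputable def move (i : I) (x : X i) (c : C) : C :=
  ((col.panelEquiv (S.panelOf i c)).symm x).1

theorem move_adj (i : I) (x : X i) (c : C) : S.adj i (col.move i x c) c :=
  ((col.panelEquiv (S.panelOf i c)).symm x).2

theorem move_apply_self (i : I) (x : X i) (c : C) : col.toFun (col.move i x c) i = x :=
  (col.panelEquiv (S.panelOf i c)).apply_symm_apply x

theorem move_apply_of_ne {i j : I} (h : j ≠ i) (x : X i) (c : C) :
    col.toFun (col.move i x c) j = col.toFun c j :=
  col.apply_eq_of_adj h (col.move_adj i x c)

theorem eq_move {i : I} {x : X i} {c d : C} (h : S.adj i d c) (hx : col.toFun d i = x) :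
    d = col.move i x c :=
  col.eq_of_adj ((S.adj i).trans h ((S.adj i).symm (col.move_adj i x c)))
    (hx.trans (col.move_apply_self i x c).symm)

theorem move_self (i : I) (c : C) : col.move i (col.toFun c i) c = c :=
  (col.eq_move ((S.adj i).refl c) rfl).symm

theorem move_move (i : I) (x y : X i) (c : C) :
    col.move i y (col.move i x c) = col.move i y c :=
  col.eq_move ((S.adj i).trans (col.move_adj _ _ _) (col.move_adj _ _ _))
    (col.move_apply_self _ _ _)

variable {col col'} in
theorem toFun_move_eq {c c' : C} (h : col'.toFun c' = col.toFun c) (i : I) (x : X i) :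
    col'.toFun (col'.move i x c') = col.toFun (col.move i x c) := by
  funext j
  rcases eq_or_ne j i with rfl | hj
  · rw [move_apply_self, move_apply_self]
  · rw [move_apply_of_ne _ hj, move_apply_of_ne _ hj, h]

/-- The chamber at the end of the (possibly stuttering) gallery starting at `c` whose steps have
the prescribed types and colours. -/
noncomputable def follow (w : List (Σ i, X i)) (c : C) : C :=
  w.foldl (fun c s => col.move s.1 s.2 c) c

theorem follow_nil (c : C) : col.follow [] c = c := rfl

theorem follow_cons (s : Σ i, X i) (w : List (Σ i, X i)) (c : C) :
    col.follow (s :: w) c = col.follow w (col.move s.1 s.2 c) := rfl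

theorem follow_append (w v : List (Σ i, X i)) (c : C) :
    col.follow (w ++ v) c = col.follow v (col.follow w c) :=
  List.foldl_append ..

variable {col col'} in
theorem toFun_follow_eq {c c' : C} (h : col'.toFun c' = col.toFun c) (w : List (Σ i, X i)) :
    col'.toFun (col'.follow w c') = col.toFun (col.follow w c) := by
  induction w generalizing c c' with
  | nil => exact h
  | cons s w ih => exact ih (toFun_move_eq h s.1 s.2)

theorem exists_follow_eq_of_hasGallery {f : List I} {c d : C} (h : S.HasGallery f c d) :
    ∃ w, w.map Sigma.fst = f ∧ col.follow w c = d := by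
  induction h with
  | nil x => exact ⟨[], rfl, rfl⟩
  | @cons i f x y z hxy hne h ih =>
    obtain ⟨w, hw, hz⟩ := ih
    refine ⟨⟨i, col.toFun y i⟩ :: w, by simp [hw], ?_⟩
    rw [follow_cons, ← col.eq_move ((S.adj i).symm hxy) rfl, hz]

variable {col col'} in
theorem exists_follow_back {c c' : C} (h : col'.toFun c' = col.toFun c) (w : List (Σ i, X i)) :
    ∃ r, col.follow r (col.follow w c) = c ∧ col'.follow r (col'.follow w c') = c' := by
  induction w generalizing c c' with
  | nil => exact ⟨[], rfl, rfl⟩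
  | cons s w ih =>
    obtain ⟨r, hr, hr'⟩ := ih (toFun_move_eq h s.1 s.2)
    refine ⟨r ++ [⟨s.1, col.toFun c s.1⟩], ?_, ?_⟩
    · rw [follow_append, col.follow_cons s, hr, follow_cons, follow_nil, move_move, move_self]
    · rw [follow_append, col'.follow_cons s, hr', follow_cons, follow_nil, move_move, ← h,
        move_self]

section Building

variable {M : CoxeterMatrix I} (hS : S.IsBuilding M) (hM : M.IsRightAngled)
include hS

theorem exists_follow_eq (c d : C) : ∃ w, col.follow w c = d := by
  obtain ⟨f, -, hf⟩ := hS.exists_hasGallery c d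
  obtain ⟨w, -, hw⟩ := col.exists_follow_eq_of_hasGallery hf
  exact ⟨w, hw⟩

variable [Finite I]
include hM

/-- A gallery of type `j i` can be replaced by one of type `i j`, and the colours identify its
middle chamber. Stuttering steps are treated separately, since galleries exclude them. -/
theorem move_comm {i j : I} (h : M i j = 2) (x : X i) (y : X j) (c : C) :
    col.move i x (col.move j y c) = col.move j y (col.move i x c) := by
  have hij := CoxeterMatrix.ne_of_apply_eq_two h
  by_cases h1 : c = col.move j y c
  · rw [← h1]
    have : y = col.toFun (col.move i x c) j := by
      rw [col.move_apply_of_ne hij.symm, h1, col.move_apply_self]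
    rw [this, move_self]
  by_cases h2 : col.move j y c = col.move i x (col.move j y c)
  · have hx : x = col.toFun c i := by
      rw [← col.move_apply_of_ne hij y c, h2, move_apply_self]
    rw [← h2, hx, move_self]
  · have h3 : S.HasGallery [j, i] c (col.move i x (col.move j y c)) :=
      .cons ((S.adj j).symm (col.move_adj j y c)) h1
        (hasGallery_singleton_iff.2 ⟨(S.adj i).symm (col.move_adj i x _), h2⟩)
    obtain _ | @⟨_, _, _, a, _, hca, -, hae⟩ :=
      hS.hasGallery_swap hM (by rw [M.symmetric, h]) h3
    rw [hasGallery_singleton_iff] at hae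
    have ha : a = col.move i x c := by
      refine col.eq_move ((S.adj i).symm hca) ?_
      rw [col.apply_eq_of_adj hij hae.1, move_apply_self]
    rw [← ha]
    refine col.eq_move ((S.adj j).symm hae.1) ?_
    rw [move_apply_of_ne _ hij.symm, move_apply_self]

theorem follow_move {j : I} (x : X j) {w : List (Σ i, X i)}
    (h : M.CanMoveToFront j (w.map Sigma.fst)) (c : C) :
    col.follow w (col.move j x c) = col.follow w c := by
  induction w generalizing c with
  | nil => exact h.elim
  | cons s w ih =>
    obtain ⟨k, y⟩ := s
    rcases h with h | ⟨h2, h⟩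
    · obtain rfl : j = k := h
      rw [follow_cons, follow_cons, move_move]
    · rw [follow_cons, follow_cons, col.move_comm hS hM (by rw [M.symmetric, h2]), ih h]

/-- Reducing a walk to a gallery uses only its types and colours and the colours of its start. Hence
one `v` serves all legal colourings with the same starting colours. -/
theorem exists_normal_follow (w : List (Σ i, X i)) (c : C) :
    ∃ v : List (Σ i, X i), v.length ≤ w.length ∧ M.IsNormal (v.map Sigma.fst) ∧
      S.HasGallery (v.map Sigma.fst) c (col.follow w c) ∧
      ∀ (col' : S.LegalColouring X) (c' : C), col'.toFun c' = col.toFun c →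
        col'.follow v c' = col'.follow w c' := by
  obtain ⟨n, hn⟩ : ∃ n, w.length = n := ⟨_, rfl⟩
  induction n using Nat.strong_induction_on generalizing w c with
  | _ n ih =>
    subst hn
    match w with
    | [] => exact ⟨[], le_rfl, trivial, .nil c, fun _ _ _ => rfl⟩
    | ⟨j, x⟩ :: t =>
      obtain ⟨t', hlen, hnorm, hgal, heq⟩ := ih t.length (by simp) t (col.move j x c) rfl
      simp only [follow_cons, List.length_cons]
      have hcol : ∀ (col' : S.LegalColouring X) (c' : C), col'.toFun c' = col.toFun c →
          col'.follow t' (col'.move j x c') = col'.follow t (col'.move j x c') :=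
        fun col' c' h => heq col' _ (toFun_move_eq h j x)
      by_cases hx : x = col.toFun c j
      · have hmove : ∀ (col' : S.LegalColouring X) (c' : C), col'.toFun c' = col.toFun c →
            col'.move j x c' = c' := fun col' c' h => by rw [hx, ← h, move_self]
        refine ⟨t', by lia, hnorm, ?_, fun col' c' h => ?_⟩
        · rwa [hmove col c rfl] at hgal ⊢
        · rw [← hcol col' c' h, hmove col' c' h]
      -- A later `j`-move overwrites the first one, which can be dropped; `t'` is then reduced
      -- again, now from `c`.
      by_cases hj : M.CanMoveToFront j (t'.map Sigma.fst)
      · obtain ⟨t'', hlen', hnorm', hgal', heq'⟩ :=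
          ih t'.length (by simp only [List.length_cons]; lia) t' c rfl
        refine ⟨t'', by lia, hnorm', ?_, fun col' c' h => ?_⟩
        · rwa [← hcol col c rfl, col.follow_move hS hM x hj]
        · rw [← hcol col' c' h, col'.follow_move hS hM x hj, heq' col' c' h]
      · refine ⟨⟨j, x⟩ :: t', by simpa using hlen, ⟨hj, hnorm⟩, ?_, hcol⟩
        refine .cons ((S.adj j).symm (col.move_adj j x c)) (fun h => hx ?_) hgal
        rw [h, move_apply_self]

variable {col col'} in
-- The reduced form of a closed walk is empty, and the same reduced form works for the other
-- colouring.
theorem follow_eq_self {c c' : C} (h : col'.toFun c' = col.toFun c) {w : List (Σ i, X i)}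
    (hw : col.follow w c = c) : col'.follow w c' = c' := by
  obtain ⟨v, -, hv, hgal, heq⟩ := col.exists_normal_follow hS hM w c
  rw [hw] at hgal
  have := hS.eq_nil_of_hasGallery_self hM hv hgal
  rw [List.map_eq_nil_iff] at this
  rw [← heq col' c' h, this, follow_nil]

variable {col col'} in
theorem follow_eq_follow {c c' : C} (h : col'.toFun c' = col.toFun c) {w v : List (Σ i, X i)}
    (hwv : col.follow w c = col.follow v c) : col'.follow w c' = col'.follow v c' := by
  obtain ⟨r, hr, hr'⟩ := exists_follow_back h w
  have h1 : col.follow (r ++ v) (col.follow w c) = col.follow w c := by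
    rw [follow_append, hr, hwv]
  have h2 := follow_eq_self hS hM (toFun_follow_eq h w) h1
  rw [follow_append, hr'] at h2
  exact h2.symm

variable {col col'} in
/-- Two legal colourings that agree at two base chambers differ by an automorphism. -/
theorem exists_automorphism {c c' : C} (h : col'.toFun c' = col.toFun c) :
    ∃ g : S.autGroup, g.1 c = c' ∧ ∀ d, col'.toFun (g.1 d) = col.toFun d := by
  choose p hp using col.exists_follow_eq hS c
  choose p' hp' using col'.exists_follow_eq hS c'
  -- Transporting a walk from `c` to `c'` depends only on its endpoint, so the choice of `p` is
  -- immaterial.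
  have hG : ∀ w, col'.follow (p (col.follow w c)) c' = col'.follow w c' := fun w =>
    follow_eq_follow hS hM h (hp _)
  have hG' : ∀ w, col.follow (p' (col'.follow w c')) c = col.follow w c := fun w =>
    follow_eq_follow hS hM h.symm (hp' _)
  let g : Equiv.Perm C :=
    { toFun := fun d => col'.follow (p d) c'
      invFun := fun d => col.follow (p' d) c
      left_inv := fun d => (hG' (p d)).trans (hp d)
      right_inv := fun d => (hG (p' d)).trans (hp' d) }
  have hg : ∀ i d e, S.adj i d e → S.adj i (g d) (g e) := by
    intro i d e hde
    have h1 := hG (p e ++ [⟨i, col.toFun d i⟩])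
    rw [follow_append, follow_append, hp, follow_cons, follow_nil, follow_cons, follow_nil,
      ← col.eq_move hde rfl] at h1
    change S.adj i (col'.follow (p d) c') _
    rw [h1]
    exact col'.move_adj i _ _
  have hg' : ∀ i d e, S.adj i d e → S.adj i (g.symm d) (g.symm e) := by
    intro i d e hde
    have h1 := hG' (p' e ++ [⟨i, col'.toFun d i⟩])
    rw [follow_append, follow_append, hp', follow_cons, follow_nil, follow_cons, follow_nil,
      ← col'.eq_move hde rfl] at h1
    change S.adj i (col.follow (p' d) c) _
    rw [h1]
    exact col.move_adj i _ _
  refine ⟨⟨g, fun i d e => ⟨fun hde => ?_, hg i d e⟩⟩, hG [], fun d => ?_⟩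
  · simpa using hg' i _ _ hde
  · exact (toFun_follow_eq h (p d)).trans (by rw [hp])

end Building

end LegalColouring

end ChamberSystem

/-! ### Wings and recolourings -/

namespace ChamberSystem

variable {I C : Type*} {S : ChamberSystem I C}

variable (S) in
/-- The `i`-wing of the chamber `c`: the chambers whose projection to the `i`-panel of `c`
is `c`. -/
def wing (M : CoxeterMatrix I) (i : I) (c : C) : Set C :=
  {d | ∃ f, M.IsNormal f ∧ S.HasGallery f c d ∧ ¬ M.CanMoveToFront i f}

theorem LegalColouring.eq_of_hasGallery {X : I → Type*} (col : S.LegalColouring X) {i : I}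
    {f : List I} {c d : C} (h : S.HasGallery f c d) (hi : i ∉ f) :
    col.toFun c i = col.toFun d i := by
  induction h with
  | nil => rfl
  | cons hxy _ _ ih =>
    rw [List.mem_cons, not_or] at hi
    rw [col.apply_eq_of_adj hi.1 hxy, ih hi.2]

namespace IsBuilding

variable {M : CoxeterMatrix I} (hS : S.IsBuilding M) (hM : M.IsRightAngled)
include hS

theorem exists_adj_ne (i : I) (c : C) : ∃ d, S.adj i d c ∧ d ≠ c := by
  obtain ⟨d, hd, hne⟩ := (hS.1 i (S.panelOf i c)).exists_ne c
  exact ⟨d, hd, hne⟩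

variable [Finite I]
include hM

theorem mem_wing_iff {i : I} {f : List I} {c d : C} (hf : M.IsNormal f)
    (h : S.HasGallery f c d) : d ∈ S.wing M i c ↔ ¬ M.CanMoveToFront i f := by
  refine ⟨?_, fun hi => ⟨f, hf, h, hi⟩⟩
  rintro ⟨g, hg, hgal, hi⟩
  rwa [← hM.isLeftDescent_iff hf, hS.wordProd_eq hM hf hg h hgal, hM.isLeftDescent_iff hg]

/-- A step across a `k`-panel lengthens the distance from `c`, or shortens it when it hits the
chamber of the panel nearest to `c`, or leaves it unchanged. -/
theorem hasGallery_step {k : I} {f : List I} {c d e : C} (hf : M.IsNormal f)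
    (h : S.HasGallery f c d) (hde : S.adj k d e) (hne : d ≠ e) :
    (M.IsNormal (f ++ [k]) ∧ S.HasGallery (f ++ [k]) c e) ∨
    ∃ t, M.IsNormal (t ++ [k]) ∧ f.Perm (t ++ [k]) ∧ S.HasGallery (t ++ [k]) c d ∧
      (S.HasGallery t c e ∨ S.HasGallery f c e) := by
  by_cases hk : M.IsNormal (f ++ [k])
  · exact Or.inl ⟨hk, hasGallery_append_iff.2 ⟨d, h, hasGallery_singleton_iff.2 ⟨hde, hne⟩⟩⟩
  obtain ⟨t, ht, hp⟩ := hf.exists_append_singleton hk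
  have htn : M.IsNormal (t ++ [k]) := by
    refine CoxeterMatrix.isNormal_of_isReduced ?_
    rw [CoxeterSystem.IsReduced, ← hp, (hM.isReduced_of_isNormal hf).eq, ht.length_eq]
  have hcd := hS.hasGallery_congr hM hf htn hp h
  refine Or.inr ⟨t, htn, ht, hcd, ?_⟩
  obtain ⟨a, hca, had⟩ := hasGallery_append_iff.1 hcd
  rw [hasGallery_singleton_iff] at had
  rcases eq_or_ne a e with rfl | hae
  · exact Or.inl hca
  · refine Or.inr (hS.hasGallery_congr hM htn hf hp.symm ?_)
    exact hasGallery_append_iff.2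
      ⟨a, hca, hasGallery_singleton_iff.2 ⟨(S.adj k).trans had.1 hde, hae⟩⟩

/-- Leaving the wing makes `i` movable to the front; the last letter must be that `i`, having
commuted past all of `f`. -/
theorem eq_of_mem_wing_of_notMem {i k : I} {f : List I} {c d e : C} (hf : M.IsNormal f)
    (h : S.HasGallery f c d) (hde : S.adj k d e) (hd : d ∈ S.wing M i c)
    (he : e ∉ S.wing M i c) : k = i ∧ ∀ b ∈ f, M i b = 2 := by
  have hne : d ≠ e := fun h => he (h ▸ hd)
  have hfi := (hS.mem_wing_iff hM hf h).1 hd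
  rcases hS.hasGallery_step hM hf h hde hne with ⟨hn, hce⟩ | ⟨t, htn, -, hcd, hce | hce⟩
  · rw [hS.mem_wing_iff hM hn hce, not_not] at he
    obtain ⟨h1, h2⟩ := he.of_append_singleton hfi
    exact ⟨h1.symm, h2⟩
  · rw [hS.mem_wing_iff hM htn.of_append hce, not_not] at he
    exact ((hS.mem_wing_iff hM htn hcd).1 hd (he.append _)).elim
  · exact (he ((hS.mem_wing_iff hM hf hce).2 hfi)).elim

theorem eq_and_apply_eq_of_mem_wing {X : I → Type*} (col : S.LegalColouring X) {i k : I}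
    {c d e : C} (hde : S.adj k d e) (hd : d ∈ S.wing M i c) (he : e ∉ S.wing M i c) :
    k = i ∧ col.toFun d i = col.toFun c i := by
  obtain ⟨f, hf, h, -⟩ := id hd
  obtain ⟨hk, hi⟩ := hS.eq_of_mem_wing_of_notMem hM hf h hde hd he
  exact ⟨hk, (col.eq_of_hasGallery h fun hif =>
    CoxeterMatrix.ne_of_apply_eq_two (hi i hif) rfl).symm⟩

theorem notMem_wing_of_adj {i : I} {c d : C} (h : S.adj i c d) (hne : c ≠ d) :
    d ∉ S.wing M i c := by
  rw [hS.mem_wing_iff hM (f := [i]) ⟨id, trivial⟩ (hasGallery_singleton_iff.2 ⟨h, hne⟩), not_not]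
  exact Or.inl rfl

open scoped Classical in
-- The number of letters `j` measures depth: a step removes at most one of them, and the wing cannot
-- be left while some `j`, which does not commute with `i`, remains.
theorem follow_mem_wing {X : I → Type*} (col : S.LegalColouring X) {i j : I} (hij : M i j = 0)
    {f : List I} {c d : C} (hf : M.IsNormal f) (h : S.HasGallery f c d)
    (hd : d ∈ S.wing M i c) (w : List (Σ i, X i)) (hw : w.length < f.count j) :
    col.follow w d ∈ S.wing M i c ∧
      ∃ t, M.IsNormal t ∧ S.HasGallery t c (col.follow w d) ∧ f.count j ≤ t.count j + w.length := by
  induction w using List.reverseRecOn with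
  | nil => exact ⟨hd, f, hf, h, le_rfl⟩
  | append_singleton w s ih =>
    simp only [List.length_append, List.length_singleton] at hw ⊢
    obtain ⟨hmem, t, ht, hgal, hcount⟩ := ih (by lia)
    rw [col.follow_append, col.follow_cons, col.follow_nil]
    have hadj := (S.adj s.1).symm (col.move_adj s.1 s.2 (col.follow w d))
    generalize col.move s.1 s.2 (col.follow w d) = e at hadj
    generalize col.follow w d = a at hadj hgal hmem
    constructor
    · by_contra he
      obtain ⟨-, hi⟩ := hS.eq_of_mem_wing_of_notMem hM ht hgal hadj hmem he
      have := hi j (List.count_pos_iff.1 (by lia))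
      lia
    · rcases eq_or_ne a e with rfl | hne
      · exact ⟨t, ht, hgal, by lia⟩
      rcases hS.hasGallery_step hM ht hgal hadj hne with ⟨hn, hce⟩ | ⟨r, hr, hp, -, hce | hce⟩
      · refine ⟨_, hn, hce, ?_⟩
        rw [List.count_append]
        lia
      · refine ⟨r, hr.of_append, hce, ?_⟩
        have h1 := hp.count_eq j
        have h2 := List.count_le_length (a := j) (l := [s.1])
        rw [List.count_append] at h1
        simp only [List.length_singleton] at h2
        lia
      · exact ⟨t, ht, hce, by lia⟩

omit hM [Finite I] in
open scoped Classical in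
theorem exists_hasGallery_two_steps {i j : I} (hij : M i j = 0) {f : List I} {c c' d : C}
    (hf : M.IsNormal f) (hi : ¬ M.CanMoveToFront i f) (h : S.HasGallery f c d)
    (hc : S.adj i c' c) (hne : c' ≠ c) :
    ∃ e g, S.adj j e c' ∧ M.IsNormal g ∧ ¬ M.CanMoveToFront i g ∧ S.HasGallery g e d ∧
      f.count j < g.count j := by
  have hji : M j i = 0 := by rw [M.symmetric, hij]
  have hne' := CoxeterMatrix.ne_of_apply_eq_zero hij
  obtain ⟨e, he, hec⟩ := hS.exists_adj_ne j c'
  refine ⟨e, j :: i :: f, he, ⟨?_, hi, hf⟩, ?_, .cons he hec (.cons hc hne h), ?_⟩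
  · rintro (h | ⟨h, -⟩)
    · exact hne' h.symm
    · lia
  · rintro (h | ⟨h, -⟩)
    · exact hne' h
    · lia
  · simp [hne']

omit hM [Finite I] in
open scoped Classical in
theorem exists_far_chamber {X : I → Type*} (col : S.LegalColouring X) {i j : I} (hij : M i j = 0)
    (x : X i) (d : C) (n : ℕ) :
    ∃ c f, col.toFun c i = x ∧ M.IsNormal f ∧ ¬ M.CanMoveToFront i f ∧ S.HasGallery f c d ∧
      n ≤ f.count j := by
  have hne := CoxeterMatrix.ne_of_apply_eq_zero hij
  have key : ∃ c f, M.IsNormal f ∧ ¬ M.CanMoveToFront i f ∧ S.HasGallery f c d ∧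
      n ≤ f.count j := by
    induction n with
    | zero => exact ⟨d, [], trivial, id, .nil d, Nat.zero_le _⟩
    | succ n ih =>
      obtain ⟨c, f, hf, hi, h, hn⟩ := ih
      obtain ⟨c', hc, hcc⟩ := hS.exists_adj_ne i c
      obtain ⟨e, g, -, hg, hgi, hgal, hlt⟩ := hS.exists_hasGallery_two_steps hij hf hi h hc hcc
      exact ⟨e, g, hg, hgi, hgal, by lia⟩
  obtain ⟨c, f, hf, hi, h, hn⟩ := key
  by_cases hx : col.toFun c i = x
  · exact ⟨c, f, hx, hf, hi, h, hn⟩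
  -- One more extension corrects the colour: its `i`-step goes to the chamber of colour `x`, and its
  -- `j`-step keeps the `i`-colour.
  · obtain ⟨e, g, he, hg, hgi, hgal, hlt⟩ := hS.exists_hasGallery_two_steps hij hf hi h
      (col.move_adj i x c) fun h => hx (by rw [← h, col.move_apply_self])
    exact ⟨e, g, by rw [col.apply_eq_of_adj hne he, col.move_apply_self], hg, hgi, hgal, by lia⟩

end IsBuilding

/-! ### Recolouring and the elements it produces -/

namespace LegalColouring

variable {X : I → Type*} (col : S.LegalColouring X)

open scoped Classical in
/-- Apply the permutation `f` to the `i`-th colour of the chambers outside `A`. -/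
noncomputable def recolourFun {i : I} (f : Equiv.Perm (X i)) (A : Set C) (c : C) : ∀ j, X j :=
  Function.update (col.toFun c) i (if c ∈ A then col.toFun c i else f (col.toFun c i))

theorem recolourFun_of_ne {i j : I} (h : j ≠ i) (f : Equiv.Perm (X i)) (A : Set C) (c : C) :
    col.recolourFun f A c j = col.toFun c j := by
  simp [recolourFun, h]

theorem recolourFun_of_mem {i : I} (f : Equiv.Perm (X i)) {A : Set C} {c : C} (h : c ∈ A) :
    col.recolourFun f A c = col.toFun c := by
  simp [recolourFun, h]

theorem recolourFun_of_notMem {i : I} (f : Equiv.Perm (X i)) {A : Set C} {c : C} (h : c ∉ A) :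
    col.recolourFun f A c i = f (col.toFun c i) := by
  simp [recolourFun, h]

section Recolour

variable {i : I} {f : Equiv.Perm (X i)} {A : Set C}
  (hA : ∀ k d e, S.adj k d e → d ∈ A → e ∉ A →
    k = i ∧ f (col.toFun d i) = col.toFun d i)
include hA

theorem recolourFun_on_panel (P : S.Panel i) :
    (∀ d ∈ P.1, col.recolourFun f A d i = col.toFun d i) ∨
    ∀ d ∈ P.1, col.recolourFun f A d i = f (col.toFun d i) := by
  by_cases h : P.1 ⊆ A
  · exact Or.inl fun d hd => by rw [col.recolourFun_of_mem f (h hd)]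
  obtain ⟨e, he, heA⟩ := Set.not_subset.1 h
  refine Or.inr fun d hd => ?_
  -- In a panel that crosses the boundary, the chambers in `A` have colours fixed by `f`, so
  -- applying `f` describes the whole panel.
  by_cases hdA : d ∈ A
  · rw [col.recolourFun_of_mem f hdA]
    obtain ⟨P, a, rfl⟩ := P
    exact (hA i d e ((S.adj i).trans hd ((S.adj i).symm he)) hdA heA).2.symm
  · exact col.recolourFun_of_notMem f hdA

/-- Permuting the `i`-th colour outside a set `A` gives a legal colouring if only `i`-panels
cross the boundary of `A`, and these at chambers with a fixed colour. -/
noncomputable def recolour : S.LegalColouring X where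
  toFun := col.recolourFun f A
  bijOn k P := by
    rcases eq_or_ne k i with rfl | hk
    · rcases col.recolourFun_on_panel hA P with h | h
      · exact (col.bijOn k P).congr fun d hd => (h d hd).symm
      · exact ((Set.bijOn_univ.2 f.bijective).comp (col.bijOn k P)).congr
          fun d hd => (h d hd).symm
    · exact (col.bijOn k P).congr fun d _ => (col.recolourFun_of_ne hk f A d).symm
  const k P j hjk c hc d hd := by
    rcases eq_or_ne j i with rfl | hj
    · obtain ⟨P, a, rfl⟩ := P
      have hcd : S.adj k c d := (S.adj k).trans hc ((S.adj k).symm hd)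
      have hcol := col.apply_eq_of_adj hjk hcd
      by_cases hcA : c ∈ A <;> by_cases hdA : d ∈ A
      · rw [col.recolourFun_of_mem f hcA, col.recolourFun_of_mem f hdA, hcol]
      · exact (hjk (hA k c d hcd hcA hdA).1.symm).elim
      · exact (hjk (hA k d c ((S.adj k).symm hcd) hdA hcA).1.symm).elim
      · rw [col.recolourFun_of_notMem f hcA, col.recolourFun_of_notMem f hdA, hcol]
    · rw [col.recolourFun_of_ne hj, col.recolourFun_of_ne hj]
      exact col.const k P j hjk c hc d hd

theorem exists_mem_universalGroup [Finite I] {M : CoxeterMatrix I} (hS : S.IsBuilding M)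
    (hM : M.IsRightAngled) {F : ∀ i, Subgroup (Equiv.Perm (X i))} (hf : f ∈ F i) {c : C}
    (hc : col.recolourFun f A c = col.toFun c) :
    ∃ g : S.autGroup, g.1 ∈ col.universalGroup F ∧ g.1 c = c ∧
      ∀ d, col.toFun (g.1 d) = col.recolourFun f A d := by
  -- With this orientation, the old colour of `g d` is the new colour of `d`, so the local actions
  -- can be read off from the recolouring.
  obtain ⟨g, hgc, hg⟩ := exists_automorphism (col := col.recolour hA) (col' := col) hS hM hc.symm
  replace hg : ∀ d, col.toFun (g.1 d) = col.recolourFun f A d := hg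
  refine ⟨g, ⟨g.2, fun k P => ?_⟩, hgc, hg⟩
  rcases eq_or_ne k i with rfl | hk
  · rcases col.recolourFun_on_panel hA P with h | h
    · rw [col.localAction_eq g P 1 fun d hd => by rw [hg, h d hd, Equiv.Perm.one_apply]]
      exact one_mem _
    · rw [col.localAction_eq g P f fun d hd => by rw [hg, h d hd]]
      exact hf
  · rw [col.localAction_eq g P 1 fun d hd => by
      rw [hg, col.recolourFun_of_ne hk, Equiv.Perm.one_apply]]
    exact one_mem _

end Recolour

theorem apply_eq_self_of_adj (g : S.autGroup) {k : I} {d e : C} (hd : g.1 d = d)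
    (hed : S.adj k e d) (he : col.toFun (g.1 e) k = col.toFun e k) : g.1 e = e := by
  have h := (g.2 k e d).2 hed
  rw [hd] at h
  exact col.eq_of_adj ((S.adj k).trans h ((S.adj k).symm hed)) he

theorem apply_eq_self_of_isCancelSMul {F : ∀ i, Subgroup (Equiv.Perm (X i))}
    (hF : ∀ i, IsCancelSMul (F i) (X i)) {g : Equiv.Perm C} (hg : g ∈ col.universalGroup F)
    {c d : C} {k : I} (hc : g c = c) (hdc : S.adj k d c) : g d = d := by
  obtain ⟨haut, hloc⟩ := hg
  refine col.apply_eq_self_of_adj ⟨g, haut⟩ hc hdc ?_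
  have h1 := col.localAction_apply ⟨g, haut⟩ (S.panelOf k c) ((S.adj k).refl c)
  have h2 := col.localAction_apply ⟨g, haut⟩ (S.panelOf k c) hdc
  have h3 : (⟨_, hloc k (S.panelOf k c)⟩ : F k) = 1 := by
    refine isCancelSMul_iff_eq_one_of_smul_eq.1 (hF k) _ (col.toFun c k) ?_
    exact h1.trans (by rw [hc])
  have h4 : col.localAction ⟨g, haut⟩ (S.panelOf k c) = 1 := congrArg Subtype.val h3
  rw [h4, Equiv.Perm.one_apply] at h2
  exact h2.symm

section Building

variable [Finite I] {M : CoxeterMatrix I} (hS : S.IsBuilding M) (hM : M.IsRightAngled)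
  {F : ∀ i, Subgroup (Equiv.Perm (X i))}
include hS

omit [Finite I] in
theorem isCancelSMul_universalGroup (hF : ∀ i, IsCancelSMul (F i) (X i)) :
    IsCancelSMul (col.universalGroup F) C := by
  rw [isCancelSMul_iff_eq_one_of_smul_eq]
  rintro ⟨g, hg⟩ c hc
  refine Subtype.ext (Equiv.ext fun d => ?_)
  obtain ⟨w, rfl⟩ := col.exists_follow_eq hS c d
  induction w using List.reverseRecOn with
  | nil => exact hc
  | append_singleton w s ih =>
    rw [follow_append]
    exact col.apply_eq_self_of_isCancelSMul hF hg ih (col.move_adj s.1 s.2 _)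

include hM

theorem isCancelSMul_of_universalGroup [Nonempty C]
    (h : IsCancelSMul (col.universalGroup F) C) (i : I) : IsCancelSMul (F i) (X i) := by
  rw [isCancelSMul_iff_eq_one_of_smul_eq] at h ⊢
  rintro ⟨f, hf⟩ x hx
  replace hx : f x = x := hx
  obtain ⟨a⟩ := ‹Nonempty C›
  have hc : col.recolourFun f ∅ (col.move i x a) = col.toFun (col.move i x a) := by
    simp [recolourFun, move_apply_self, hx]
  obtain ⟨g, hg, hgc, hgf⟩ := col.exists_mem_universalGroup (A := ∅)
    (fun _ _ _ _ h => h.elim) hS hM hf hc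
  have h1 : g.1 = 1 := congrArg Subtype.val (h ⟨g.1, hg⟩ _ hgc)
  refine Subtype.ext (Equiv.ext fun y => ?_)
  have h2 := congrFun (hgf (col.move i y a)) i
  rw [col.recolourFun_of_notMem f (Set.notMem_empty _), h1, Equiv.Perm.one_apply,
    move_apply_self] at h2
  exact h2.symm

open scoped Classical in
/-- A non-free local group at a non-isolated node yields non-trivial elements of the universal
group fixing any given finite set of chambers. -/
theorem eq_one_of_fixingSubgroup_eq_bot [Nonempty C] {i j : I} (hij : M i j = 0)
    {f : Equiv.Perm (X i)} (hf : f ∈ F i) {x : X i} (hx : f x = x) (Φ : Finset C)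
    (hΦ : ∀ g ∈ col.universalGroup F, (∀ c ∈ Φ, g c = c) → g = 1) : f = 1 := by
  obtain ⟨a⟩ := ‹Nonempty C›
  choose p hp using col.exists_follow_eq hS a
  obtain ⟨c, t, hcx, ht, hti, hgal, hn⟩ :=
    -- The `+ 1` makes every walk from `a` to a chamber of `Φ` strictly shorter than the depth of
    -- `a` in the wing.
    hS.exists_far_chamber col hij x a (Φ.sup (fun d => (p d).length) + 1)
  have ha : a ∈ S.wing M i c := ⟨t, ht, hgal, hti⟩
  obtain ⟨g, hg, hga, hgf⟩ := col.exists_mem_universalGroup (A := S.wing M i c)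
    (fun k d e hde hd he => by
      obtain ⟨hk, hdx⟩ := hS.eq_and_apply_eq_of_mem_wing hM col hde hd he
      exact ⟨hk, by rw [hdx, hcx, hx]⟩) hS hM hf (col.recolourFun_of_mem f ha)
  have hfix : ∀ w : List (Σ i, X i), w.length < t.count j →
      g.1 (col.follow w a) = col.follow w a := by
    intro w hw
    induction w using List.reverseRecOn with
    | nil => exact hga
    | append_singleton w s ih =>
      have hmem := (hS.follow_mem_wing hM col hij ht hgal ha _ hw).1
      have hcol := (hgf (col.follow (w ++ [s]) a)).trans (col.recolourFun_of_mem f hmem)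
      rw [List.length_append, List.length_singleton] at hw
      rw [follow_append] at hcol ⊢
      exact col.apply_eq_self_of_adj g (ih (by lia)) (col.move_adj s.1 s.2 _) (congrFun hcol _)
  have h1 : g.1 = 1 := hΦ g.1 hg fun d hd => by
    have := Finset.le_sup (f := fun d => (p d).length) hd
    have h2 := hfix (p d) (by lia)
    rwa [hp] at h2
  refine Equiv.ext fun y => ?_
  rcases eq_or_ne y x with rfl | hy
  · exact hx
  -- In the `i`-panel of `c`, only `c` lies in the wing, so `f` is visible at every other colour.
  have hmem : col.move i y c ∉ S.wing M i c := by
    refine hS.notMem_wing_of_adj hM ((S.adj i).symm (col.move_adj i y c)) fun h => hy ?_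
    rw [← hcx, h, move_apply_self]
  have h2 := congrFun (hgf (col.move i y c)) i
  rw [col.recolourFun_of_notMem f hmem, h1, Equiv.Perm.one_apply, move_apply_self] at h2
  exact h2.symm

end Building

end LegalColouring

end ChamberSystem

/-! ### Discreteness -/

theorem discreteTopology_permutationTopology_iff {X : Type*} (G : Subgroup (Equiv.Perm X)) :
    @DiscreteTopology G (permutationTopology G) ↔
      ∃ Φ : Finset X, ∀ g ∈ G, (∀ c ∈ Φ, g c = c) → g = 1 := by
  let _ := permutationTopology G
  have : IsTopologicalGroup G := (permutationBasis G).isTopologicalGroup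
  rw [discreteTopology_iff_isOpen_singleton_one, isOpen_iff_mem_nhds]
  simp only [Set.mem_singleton_iff, forall_eq]
  rw [(permutationBasis G).nhds_one_hasBasis.mem_iff]
  constructor
  · rintro ⟨_, ⟨Φ, rfl⟩, h⟩
    refine ⟨Φ, fun g hg hfix => ?_⟩
    have : (⟨g, hg⟩ : G) ∈ ({1} : Set G) :=
      h ((mem_fixingSubgroup_iff G).2 fun c hc => hfix c (Finset.mem_coe.1 hc))
    exact congrArg Subtype.val this
  · rintro ⟨Φ, h⟩
    refine ⟨_, ⟨Φ, rfl⟩, fun g hg => Subtype.ext (h g.1 g.2 fun c hc => ?_)⟩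
    exact (mem_fixingSubgroup_iff G).1 hg c (Finset.mem_coe.2 hc)

theorem discreteTopology_of_isCancelSMul {X : Type*} [Nonempty X]
    (G : Subgroup (Equiv.Perm X)) (h : IsCancelSMul G X) :
    @DiscreteTopology G (permutationTopology G) := by
  obtain ⟨x⟩ := ‹Nonempty X›
  refine (discreteTopology_permutationTopology_iff G).2 ⟨{x}, fun g hg hx => ?_⟩
  exact congrArg Subtype.val
    (isCancelSMul_iff_eq_one_of_smul_eq.1 h ⟨g, hg⟩ x (hx x (Finset.mem_singleton_self x)))

theorem mainTheorem12 {I : Type w} [Finite I] {C : Type u} [Nonempty C] {X : I → Type v}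
    (M : CoxeterMatrix I) (hM : M.IsRightAngled)
    (S : ChamberSystem I C) (hS : S.IsBuilding M)
    (q : I → Cardinal.{u}) (hq : S.IsSemiregular q)
    (hX : ∀ i, Cardinal.lift.{u} (Cardinal.mk (X i)) = Cardinal.lift.{v} (q i))
    (col : S.LegalColouring X) (F : ∀ i, Subgroup (Equiv.Perm (X i))) :
    ((∀ i, IsCancelSMul (F i) (X i)) ↔ IsCancelSMul (col.universalGroup F) C) ∧
    (IsCancelSMul (col.universalGroup F) C →
      @DiscreteTopology (col.universalGroup F) (permutationTopology (col.universalGroup F))) ∧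
    ((∀ i, ¬ M.diagram.IsIsolated i) →
      List.TFAE [
        ∀ i, IsCancelSMul (F i) (X i),
        IsCancelSMul (col.universalGroup F) C,
        @DiscreteTopology (col.universalGroup F)
          (permutationTopology (col.universalGroup F))]) := by
  have h12 := col.isCancelSMul_universalGroup hS (F := F)
  have h21 := col.isCancelSMul_of_universalGroup hS hM (F := F)
  have h23 := discreteTopology_of_isCancelSMul (col.universalGroup F)
  refine ⟨⟨h12, h21⟩, h23, fun hiso => ?_⟩
  tfae_have 1 → 2 := h12
  tfae_have 2 → 3 := h23
  tfae_have 3 → 1 := by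
    intro h i
    obtain ⟨Φ, hΦ⟩ := (discreteTopology_permutationTopology_iff _).1 h
    have hi := hiso i
    simp only [SimpleGraph.IsIsolated, not_forall, not_not] at hi
    obtain ⟨j, hne, hj⟩ := hi
    rw [isCancelSMul_iff_eq_one_of_smul_eq]
    rintro ⟨f, hf⟩ x hx
    exact Subtype.ext (col.eq_one_of_fixingSubgroup_eq_bot hS hM
      ((hM i j hne).resolve_left hj) hf hx Φ hΦ)
  tfae_finish
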